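/- Let $(\Omega,\mathcal A,\mu)$ be a probability space, let $E,F$ be separable real Banach spaces with duals $E',F'$, and let $X:\Omega\to E$ and $Y:\Omega\to F$ be jointly Gaussian random variables (that is, $e'(X)+f'(Y)$ is a possibly degenerate real Gaussian variable for all $e'\in E'$, $f'\in F'$) with $\mathbb E(X)=0$ and $\mathbb E(Y)=0$. Let $\sigma(Y)$ be the smallest $\sigma$-algebra making all $f'(Y)$, $f'\in F'$, measurable, and let $Z=\mathbb E(X\mid\sigma(Y))$. For a centred Gaussian random variable $U$ with values in a separable Banach space $B$ write: * $G_U=\overline{\{b'(U): b'\in B'\}}\subseteq L^2(\mu)$; * $\operatorname{cov}(U)b'=\mathbb E(b'(U)U)$ for $b'\in B'$, and $k_U(b_1',b_2')=\langle \operatorname{cov}(U)b_1',b_2'\rangle$ for $b_1',b_2'$ in the closed unit ball $B_{B'}$ of $B'$; * $W_U=\{\int_\Omega gU\,d\mu : g\in G_U\}\subseteq B$ with norm $\|w\|_{W_U}=\inf\{\|g\|_{L^2(\mu)}: g\in G_U,\ w=\int_\Omega gU\,d\mu\}$, which is a Hilbert norm; * $H_U$ for the Hilbert space of the functions $b'\mapsto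 b'(w)$ on $B_{B'}$, $w\in W_U$, with the scalar product of $W_U$. It is the reproducing kernel Hilbert space on $B_{B'}$ with kernel $k_U$. Suppose that $Y=LX$ almost surely for a bounded linear operator $L:E\to F$, with adjoint $L':F'\to E'$. Then $Z$ is a centred Gaussian random variable, $$G_Z=G_Y\subseteq G_X ,$$ and the kernel $k_Z$ of $H_Z$ is given by $$k_Z(\,\cdot\,,e')=\Pi_{H(\mathcal E)}\,k_X(\,\cdot\,,e')\qquad\text{for all } e'\in B_{E'},$$ where $\Pi_{H(\mathcal E)}$ is the orthogonal projection in $H_X$ onto $$H(\mathcal E)=\overline{\operatorname{span}\{k_X(\,\cdot\,,L'f') : f'\in F',\ L'f'\in B_{E'}\}}^{\,\|\cdot\|_{H_X}} .$$ -/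

import Mathlib

open MeasureTheory ProbabilityTheory
open scoped RealInnerProductSpace

noncomputable section

namespace GaussianConditioning

/-! ### The generated σ-algebra -/

/-- `σ(Y)`: the smallest σ-algebra on `Ω` for which `Y : Ω → F` is weakly measurable, that is, for
which all scalar functions `f' ∘ Y`, with `f'` in the dual of `F`, are measurable. -/
abbrev sigmaAlg {Ω F : Type*} [NormedAddCommGroup F] [NormedSpace ℝ F] (Y : Ω → F) :
    MeasurableSpace Ω :=
  ⨆ f' : StrongDual ℝ F, MeasurableSpace.comap (fun ω => f' (Y ω)) (borel ℝ)

section Spaces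

variable {Ω E : Type*} {mΩ : MeasurableSpace Ω} {μ : Measure Ω}
  [NormedAddCommGroup E] [NormedSpace ℝ E]

/-! ### The Gaussian Hilbert space -/

/-- The linear space of the `μ`-equivalence classes `e'(X)` in `L²(μ)`, `e'` in the dual of `E`. -/
def functionals (μ : Measure Ω) (X : Ω → E) : Submodule ℝ (Lp ℝ 2 μ) where
  carrier := {g | ∃ e' : StrongDual ℝ E, (g : Ω → ℝ) =ᵐ[μ] fun ω => e' (X ω)}
  zero_mem' := ⟨0, Lp.coeFn_zero ℝ 2 μ⟩
  add_mem' := by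
    rintro g h ⟨a, ha⟩ ⟨b, hb⟩
    refine ⟨a + b, ?_⟩
    filter_upwards [Lp.coeFn_add g h, ha, hb] with ω h1 h2 h3
    rw [h1, Pi.add_apply, h2, h3, add_apply]
  smul_mem' := by
    rintro c g ⟨a, ha⟩
    refine ⟨c • a, ?_⟩
    filter_upwards [Lp.coeFn_smul c g, ha] with ω h1 h2
    simp [h1, h2]

/-- `G_X`: the closure in `L²(μ)` of `{e'(X) : e' ∈ E'}`. -/
def gaussianSpace (μ : Measure Ω) (X : Ω → E) : Submodule ℝ (Lp ℝ 2 μ) :=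
  (functionals μ X).topologicalClosure

instance instCompleteGaussianSpace (X : Ω → E) : CompleteSpace (gaussianSpace μ X) :=
  (Submodule.isClosed_topologicalClosure _).completeSpace_coe

/-! ### Covariance operator and kernel -/

/-- The covariance operator `cov(X) e' = 𝔼(e'(X) X)` of a centred random variable. -/
def cov (μ : Measure Ω) (X : Ω → E) (e' : StrongDual ℝ E) : E :=
  ∫ ω, e' (X ω) • X ω ∂μ

/-- The closed unit ball `B_{E'}` of the dual of `E`. -/
abbrev DualBall (E : Type*) [NormedAddCommGroup E] [NormedSpace ℝ E] : Type _ :=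
  ↥(Metric.closedBall (0 : StrongDual ℝ E) 1)

/-- The kernel `k_X(e₁', e₂') = ⟨cov(X) e₁', e₂'⟩` on `B_{E'}`. -/
def covKernel (μ : Measure Ω) (X : Ω → E) (e₁ e₂ : DualBall E) : ℝ :=
  (e₂ : StrongDual ℝ E) (cov μ X e₁)

/-- The linear map `e ↦ (e' ↦ e'(e))`, from `E` to the functions on `B_{E'}`. -/
def evalMap (E : Type*) [NormedAddCommGroup E] [NormedSpace ℝ E] : E →ₗ[ℝ] (DualBall E → ℝ) where
  toFun e := fun e' => (e' : StrongDual ℝ E) e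
  map_add' x y := by ext e'; simp
  map_smul' c x := by ext e'; simp

theorem evalMap_injective : Function.Injective (evalMap E) := by
  refine (injective_iff_map_eq_zero _).2 fun e he => ?_
  by_contra h0
  obtain ⟨f, hf, hfe⟩ := exists_dual_vector ℝ e (norm_ne_zero_iff.2 h0)
  have h1 : f e = 0 := congrFun he ⟨f, by simp [hf]⟩
  rw [h1] at hfe
  exact h0 (norm_eq_zero.1 (by simpa using hfe.symm))

/-! ### The abstract Wiener space -/

variable {X : Ω → E}

theorem integrable_smul (hX : MemLp X 2 μ) (g : Lp ℝ 2 μ) :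
    Integrable (fun ω => g ω • X ω) μ :=
  memLp_one_iff_integrable.1 (MemLp.smul (r := 1) hX (Lp.memLp g))

/-- The map `g ↦ ∫ g X dμ` on `L²(μ)`. -/
def wienerMap (hX : MemLp X 2 μ) : Lp ℝ 2 μ →ₗ[ℝ] E where
  toFun g := ∫ ω, g ω • X ω ∂μ
  map_add' g h := by
    rw [← integral_add (integrable_smul hX g) (integrable_smul hX h)]
    refine integral_congr_ae ?_
    filter_upwards [Lp.coeFn_add g h] with ω h1
    rw [h1, Pi.add_apply, add_smul]
  map_smul' c g := by
    rw [RingHom.id_apply, ← integral_smul]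
    refine integral_congr_ae ?_
    filter_upwards [Lp.coeFn_smul c g] with ω h1
    simp [h1, mul_smul]

/-- The class of `e'(X)` in `L²(μ)`. -/
def functional (hX : MemLp X 2 μ) (e' : StrongDual ℝ E) : Lp ℝ 2 μ :=
  (e'.comp_memLp' hX).toLp

theorem coeFn_functional (hX : MemLp X 2 μ) (e' : StrongDual ℝ E) :
    (functional hX e' : Ω → ℝ) =ᵐ[μ] fun ω => e' (X ω) :=
  MemLp.coeFn_toLp (e'.comp_memLp' hX)

theorem functional_mem_functionals (hX : MemLp X 2 μ) (e' : StrongDual ℝ E) :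
    functional hX e' ∈ functionals μ X :=
  ⟨e', coeFn_functional hX e'⟩

theorem functional_mem (hX : MemLp X 2 μ) (e' : StrongDual ℝ E) :
    functional hX e' ∈ gaussianSpace μ X :=
  Submodule.le_topologicalClosure _ (functional_mem_functionals hX e')

theorem cov_eq_wienerMap (hX : MemLp X 2 μ) (e' : StrongDual ℝ E) :
    cov μ X e' = wienerMap hX (functional hX e') := by
  refine integral_congr_ae ?_
  filter_upwards [coeFn_functional hX e'] with ω h
  rw [h]

variable [CompleteSpace E]

theorem apply_wienerMap (hX : MemLp X 2 μ) (g : Lp ℝ 2 μ) (e' : StrongDual ℝ E) :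
    e' (wienerMap hX g) = ⟪functional hX e', g⟫ := by
  rw [L2.inner_def]
  change e' (∫ ω, g ω • X ω ∂μ) = _
  rw [← ContinuousLinearMap.integral_comp_comm _ (integrable_smul hX g)]
  refine integral_congr_ae ?_
  filter_upwards [coeFn_functional hX e'] with ω h
  simp [h]

theorem wienerMap_injOn (hX : MemLp X 2 μ) (g : Lp ℝ 2 μ) (hg : g ∈ gaussianSpace μ X)
    (h0 : wienerMap hX g = 0) : g = 0 := by
  have h1 : ∀ f ∈ functionals μ X, ⟪f, g⟫ = 0 := by
    rintro f ⟨e', he'⟩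
    have : f = functional hX e' := Lp.ext (he'.trans (coeFn_functional hX e').symm)
    rw [this, ← apply_wienerMap, h0, map_zero]
  have h2 : g ∈ (functionals μ X)ᗮ := (Submodule.mem_orthogonal _ _).2 h1
  rw [← Submodule.orthogonal_closure] at h2
  exact inner_self_eq_zero.1 ((Submodule.mem_orthogonal _ _).1 h2 g hg)

/-- The vector space `{∫ g X dμ : g ∈ G_X}`, a linear subspace of `E`. -/
def wienerSubmodule (hX : MemLp X 2 μ) : Submodule ℝ E :=
  (gaussianSpace μ X).map (wienerMap hX)

/-- The abstract Wiener space `W_X = {∫ g X dμ : g ∈ G_X}`, as a type of its own: it carries the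
Hilbert space structure below and not the norm of `E`. -/
def WienerSpace (hX : MemLp X 2 μ) : Type _ := ↥(wienerSubmodule hX)

instance instAddCommGroupWiener (hX : MemLp X 2 μ) : AddCommGroup (WienerSpace hX) :=
  inferInstanceAs (AddCommGroup ↥(wienerSubmodule hX))

instance instModuleWiener (hX : MemLp X 2 μ) : Module ℝ (WienerSpace hX) :=
  inferInstanceAs (Module ℝ ↥(wienerSubmodule hX))

/-- The bijection `V_X : G_X → W_X`, `V_X g = ∫ g X dμ`. -/
def wienerEquiv (hX : MemLp X 2 μ) : gaussianSpace μ X ≃ₗ[ℝ] WienerSpace hX :=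
  LinearEquiv.ofBijective
    ((wienerMap hX).restrict (p := gaussianSpace μ X) (q := wienerSubmodule hX)
      fun _ hg => Submodule.mem_map_of_mem hg)
    ⟨(injective_iff_map_eq_zero _).2 fun g hg =>
        Subtype.ext (wienerMap_injOn hX g g.2 (congrArg Subtype.val hg)),
      fun ⟨_, g, hg, h⟩ => ⟨⟨g, hg⟩, Subtype.ext h⟩⟩

instance instNormedWiener (hX : MemLp X 2 μ) : NormedAddCommGroup (WienerSpace hX) :=
  NormedAddCommGroup.induced _ _ (wienerEquiv hX).symm (wienerEquiv hX).symm.injective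

/-- The scalar product that makes `V_X` unitary. -/
instance instInnerWiener (hX : MemLp X 2 μ) : InnerProductSpace ℝ (WienerSpace hX) where
  inner v w := ⟪(wienerEquiv hX).symm v, (wienerEquiv hX).symm w⟫
  norm_smul_le c v := by
    change ‖(wienerEquiv hX).symm (c • v)‖ ≤ ‖c‖ * ‖(wienerEquiv hX).symm v‖
    rw [map_smul, norm_smul]
  norm_sq_eq_re_inner v := norm_sq_eq_re_inner (𝕜 := ℝ) ((wienerEquiv hX).symm v)
  conj_inner_symm v w := inner_conj_symm _ _
  add_left u v w := by simp [inner_add_left]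
  smul_left v w c := by simp [inner_smul_left]

/-- `V_X` as an isometric isomorphism. -/
def wienerIsometry (hX : MemLp X 2 μ) : gaussianSpace μ X ≃ₗᵢ[ℝ] WienerSpace hX where
  toLinearEquiv := wienerEquiv hX
  norm_map' g := by
    change ‖(wienerEquiv hX).symm (wienerEquiv hX g)‖ = ‖g‖
    rw [LinearEquiv.symm_apply_apply]

theorem wienerIsometry_coe (hX : MemLp X 2 μ) (g : gaussianSpace μ X) :
    (wienerIsometry hX g).val = ∫ ω, (g : Lp ℝ 2 μ) ω • X ω ∂μ := rfl

/-- The norm of `W_X` is the norm defined by the infimum over all representing `g ∈ G_X`. -/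
theorem wiener_norm_eq (hX : MemLp X 2 μ) (w : WienerSpace hX) :
    ‖w‖ = sInf {r : ℝ | ∃ g ∈ gaussianSpace μ X, w.val = ∫ ω, g ω • X ω ∂μ ∧ r = ‖g‖} := by
  obtain ⟨g, rfl⟩ := (wienerIsometry hX).surjective w
  have : {r : ℝ | ∃ h ∈ gaussianSpace μ X,
      (wienerIsometry hX g).val = ∫ ω, h ω • X ω ∂μ ∧ r = ‖h‖} = {‖g‖} := by
    ext r
    constructor
    · rintro ⟨h, hh, e, rfl⟩
      have e' : wienerIsometry hX g = wienerIsometry hX ⟨h, hh⟩ := Subtype.ext e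
      rw [(wienerIsometry hX).injective e']
      rfl
    · rintro rfl
      exact ⟨g, g.2, rfl, rfl⟩
  rw [this, csInf_singleton, LinearIsometryEquiv.norm_map]

instance instCompleteWiener (hX : MemLp X 2 μ) : CompleteSpace (WienerSpace hX) :=
  (wienerIsometry hX).toIsometryEquiv.completeSpace_iff.1 inferInstance

/-! ### The reproducing covariance space -/

/-- The vector space of the functions `e' ↦ e'(w)` on `B_{E'}`, for `w ∈ W_X`. -/
def covSubmodule (hX : MemLp X 2 μ) : Submodule ℝ (DualBall E → ℝ) :=
  (wienerSubmodule hX).map (evalMap E)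

/-- The reproducing covariance space `H_X`: the functions `e' ↦ e'(w)` on `B_{E'}`, `w ∈ W_X`, as a
type of its own, with the Hilbert space structure of `W_X`. -/
def CovSpace (hX : MemLp X 2 μ) : Type _ := ↥(covSubmodule hX)

instance instAddCommGroupCov (hX : MemLp X 2 μ) : AddCommGroup (CovSpace hX) :=
  inferInstanceAs (AddCommGroup ↥(covSubmodule hX))

instance instModuleCov (hX : MemLp X 2 μ) : Module ℝ (CovSpace hX) :=
  inferInstanceAs (Module ℝ ↥(covSubmodule hX))

/-- The bijection `ι_X : W_X → H_X`, `(ι_X w)(e') = e'(w)`. -/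
def covEquiv (hX : MemLp X 2 μ) : WienerSpace hX ≃ₗ[ℝ] CovSpace hX :=
  LinearEquiv.ofBijective
    ((evalMap E).restrict (p := wienerSubmodule hX) (q := covSubmodule hX)
      fun _ hw => Submodule.mem_map_of_mem hw)
    ⟨fun _ _ h => Subtype.ext (evalMap_injective (congrArg Subtype.val h)),
      fun ⟨_, w, hw, h⟩ => ⟨⟨w, hw⟩, Subtype.ext h⟩⟩

instance instNormedCov (hX : MemLp X 2 μ) : NormedAddCommGroup (CovSpace hX) :=
  NormedAddCommGroup.induced _ _ (covEquiv hX).symm (covEquiv hX).symm.injective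

/-- The scalar product of `W_X`, carried over to `H_X`. -/
instance instInnerCov (hX : MemLp X 2 μ) : InnerProductSpace ℝ (CovSpace hX) where
  inner f g := ⟪(covEquiv hX).symm f, (covEquiv hX).symm g⟫
  norm_smul_le c f := by
    change ‖(covEquiv hX).symm (c • f)‖ ≤ ‖c‖ * ‖(covEquiv hX).symm f‖
    rw [map_smul, norm_smul]
  norm_sq_eq_re_inner f := norm_sq_eq_re_inner (𝕜 := ℝ) ((covEquiv hX).symm f)
  conj_inner_symm f g := inner_conj_symm _ _
  add_left f g h := by simp [inner_add_left]
  smul_left f g c := by simp [inner_smul_left]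

/-- `ι_X` as an isometric isomorphism. -/
def covIsometry (hX : MemLp X 2 μ) : WienerSpace hX ≃ₗᵢ[ℝ] CovSpace hX where
  toLinearEquiv := covEquiv hX
  norm_map' w := by
    change ‖(covEquiv hX).symm (covEquiv hX w)‖ = ‖w‖
    rw [LinearEquiv.symm_apply_apply]

theorem covIsometry_coe (hX : MemLp X 2 μ) (w : WienerSpace hX) (e' : DualBall E) :
    (covIsometry hX w).val e' = (e' : StrongDual ℝ E) w.val := rfl

instance instCompleteCov (hX : MemLp X 2 μ) : CompleteSpace (CovSpace hX) :=
  (covIsometry hX).toIsometryEquiv.completeSpace_iff.1 inferInstance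

/-- Evaluation at `e'`, expressed through the unitary map `G_X → W_X → H_X`. -/
theorem covSpace_val_apply (hX : MemLp X 2 μ) (f : CovSpace hX) (e' : DualBall E) :
    f.val e' =
      ⟪covIsometry hX (wienerIsometry hX ⟨functional hX e', functional_mem hX e'⟩), f⟫ := by
  obtain ⟨w, rfl⟩ := (covIsometry hX).surjective f
  obtain ⟨g, rfl⟩ := (wienerIsometry hX).surjective w
  rw [LinearIsometryEquiv.inner_map_map, LinearIsometryEquiv.inner_map_map]
  exact apply_wienerMap hX g e'

/-- `H_X` is a reproducing kernel Hilbert space of functions on `B_{E'}`. -/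
instance instRKHSCov (hX : MemLp X 2 μ) : RKHS ℝ (CovSpace hX) (DualBall E) ℝ where
  coeCLM :=
    { toLinearMap := (covSubmodule hX).subtype
      cont := continuous_pi fun e' => by
        change Continuous fun f : CovSpace hX => f.val e'
        simp_rw [covSpace_val_apply]
        fun_prop }
  coeCLM_injective := Subtype.val_injective

theorem covSpace_apply (hX : MemLp X 2 μ) (f : CovSpace hX) (e' : DualBall E) :
    f e' = f.val e' := rfl

/-- The kernel function `k_X(·, e')` as an element of `H_X`. -/
def kernelFun (hX : MemLp X 2 μ) (e' : DualBall E) : CovSpace hX :=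
  ⟨fun e₁ => covKernel μ X e₁ e', cov μ X e', by
    rw [cov_eq_wienerMap hX]
    exact Submodule.mem_map_of_mem (functional_mem hX e'), by
    ext e₁
    change (e₁ : StrongDual ℝ E) (cov μ X e') = (e' : StrongDual ℝ E) (cov μ X e₁)
    rw [cov_eq_wienerMap hX, cov_eq_wienerMap hX, apply_wienerMap, apply_wienerMap,
      real_inner_comm]⟩

theorem kernelFun_apply (hX : MemLp X 2 μ) (e₁ e' : DualBall E) :
    kernelFun hX e' e₁ = covKernel μ X e₁ e' := rfl

theorem kernelFun_eq (hX : MemLp X 2 μ) (e' : DualBall E) :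
    kernelFun hX e' =
      covIsometry hX (wienerIsometry hX ⟨functional hX e', functional_mem hX e'⟩) := by
  refine Subtype.ext (funext fun e₁ => ?_)
  change (e' : StrongDual ℝ E) (cov μ X e₁) =
    (e₁ : StrongDual ℝ E) (wienerMap hX (functional hX e'))
  rw [cov_eq_wienerMap hX, apply_wienerMap, apply_wienerMap, real_inner_comm]

/-- `k_X` is the reproducing kernel of `H_X`. -/
theorem rkhs_kernel_covSpace (hX : MemLp X 2 μ) (e₁ e₂ : DualBall E) :
    RKHS.kernel (CovSpace hX) e₁ e₂ 1 = covKernel μ X e₁ e₂ := by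
  rw [← RKHS.kerFun_apply, ← kernelFun_apply hX]
  congr 1
  refine ext_inner_right ℝ fun f => ?_
  rw [RKHS.kerFun_inner, kernelFun_eq, ← covSpace_val_apply]
  simp [covSpace_apply]

/-- `H(𝓔)`: the closed linear span in `H_X` of the kernel functions `k_X(·, e')`, `e' ∈ 𝓔`. -/
def closedKernelSpan (hX : MemLp X 2 μ) (𝓔 : Set (DualBall E)) : Submodule ℝ (CovSpace hX) :=
  (Submodule.span ℝ (kernelFun hX '' 𝓔)).topologicalClosure

instance instCompleteClosedKernelSpan (hX : MemLp X 2 μ) (𝓔 : Set (DualBall E)) :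
    CompleteSpace (closedKernelSpan hX 𝓔) :=
  (Submodule.isClosed_topologicalClosure _).completeSpace_coe

end Spaces

end GaussianConditioning

end

namespace GaussianConditioning

/-! On `G_X`, conditioning on `Y` is the orthogonal projection `P` onto `G_Y`. For `g ∈ G_X` the
remainder `g - Pg` is orthogonal to `G_Y`, hence independent of `Y` because joint characteristic
functions of centred Gaussians factor under orthogonality (`indepFun_of_orthogonal`). Its
conditional expectation is therefore its mean, zero, while `Pg` is already `σ(Y)`-measurable
(`condExp_eq_starProjection`).

Applied to `e'(X)` this gives `e'(Z) = P e'(X)`, so `Z` is centred Gaussian with `G_Z ⊆ G_Y`.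
Conversely `P` fixes `f'(Y) = (L'f')(X)`, so `f'(Y) = (L'f')(Z)`.

The unitary map `G_X → H_X` sends `e'(X)` to `k_X(·, e')` and turns `P` into the projection onto
`H(𝓔)` (`starProjection_kernelFun`). The kernel formula is then `⟪P e₁(X), P e'(X)⟫ = ⟪e₁(X), P
e'(X)⟫`. -/

theorem norm_sq_Lp_two {Ω : Type*} {mΩ : MeasurableSpace Ω} {μ : Measure Ω}
    (g : Lp ℝ 2 μ) : ‖g‖ ^ 2 = ∫ ω, g ω ^ 2 ∂μ := by
  rw [← real_inner_self_eq_norm_sq, L2.inner_def]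
  simp [pow_two]

/-! ### Gaussian Hilbert spaces and the transport of projections to `H_X` -/

section Hilbert

variable {Ω E F : Type*} {mΩ : MeasurableSpace Ω} {μ : Measure Ω}
  [NormedAddCommGroup E] [NormedSpace ℝ E] [NormedAddCommGroup F] [NormedSpace ℝ F]
  {X : Ω → E} {Y : Ω → F}

/-- Density argument used for measurability, zero mean, characteristic functions and membership in
`H(𝓔)`. -/
theorem gaussianSpace_induction {p : Lp ℝ 2 μ → Prop} (hp : IsClosed {g | p g})
    (h : ∀ g ∈ functionals μ X, p g) {g : Lp ℝ 2 μ} (hg : g ∈ gaussianSpace μ X) : p g :=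
  closure_minimal (s := (functionals μ X : Set (Lp ℝ 2 μ))) h hp hg

theorem functionals_le_of_ae_eq_comp {L : E →L[ℝ] F} (hL : Y =ᵐ[μ] fun ω => L (X ω)) :
    functionals μ Y ≤ functionals μ X := by
  rintro g ⟨f', hf'⟩
  refine ⟨f' ∘L L, ?_⟩
  filter_upwards [hf', hL] with ω h1 h2
  rw [h1, h2]
  rfl

theorem measurable_apply_sigmaAlg (Y : Ω → F) (f' : StrongDual ℝ F) :
    Measurable[sigmaAlg Y] fun ω => f' (Y ω) := by
  refine measurable_iff_comap_le.2 ?_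
  rw [BorelSpace.measurable_eq (α := ℝ)]
  exact le_iSup (fun f' : StrongDual ℝ F =>
    MeasurableSpace.comap (fun ω => f' (Y ω)) (borel ℝ)) f'

/-- Kernel functions are indexed by the unit ball only, so `L'f'` has to be rescaled into it. -/
theorem exists_eq_smul_functional (hX : MemLp X 2 μ) {L : E →L[ℝ] F}
    (hL : Y =ᵐ[μ] fun ω => L (X ω)) {g : Lp ℝ 2 μ} (hg : g ∈ functionals μ Y) :
    ∃ (r : ℝ) (l : DualBall E), (∃ f' : StrongDual ℝ F, (l : StrongDual ℝ E) = f' ∘L L) ∧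
      g = r • functional hX l := by
  obtain ⟨f', hf'⟩ := hg
  -- The summand `1` keeps the scaling factor invertible when `f' ∘L L = 0`.
  have hr : 0 < ‖f' ∘L L‖ + 1 := by positivity
  generalize hr' : ‖f' ∘L L‖ + 1 = r at hr
  have hl : (r⁻¹ • f') ∘L L ∈ Metric.closedBall (0 : StrongDual ℝ E) 1 := by
    rw [mem_closedBall_zero_iff, ContinuousLinearMap.smul_comp, norm_smul, norm_inv,
      Real.norm_of_nonneg hr.le, inv_mul_le_iff₀ hr]
    linarith
  refine ⟨r, ⟨_, hl⟩, ⟨_, rfl⟩, Lp.ext ?_⟩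
  filter_upwards [hf', hL, Lp.coeFn_smul r (functional hX ((r⁻¹ • f') ∘L L)),
    coeFn_functional hX ((r⁻¹ • f') ∘L L)] with ω h1 h2 h3 h4
  rw [h1, h3, Pi.smul_apply, h4, h2]
  simp [hr.ne']

variable [CompleteSpace E]

theorem covKernel_eq_inner (hX : MemLp X 2 μ) (e₁ e₂ : DualBall E) :
    covKernel μ X e₁ e₂ = ⟪functional hX e₁, functional hX e₂⟫ := by
  rw [covKernel, cov_eq_wienerMap hX, apply_wienerMap, real_inner_comm]

/-- The unitary map `G_X → H_X`. -/
noncomputable def gaussianIsometry (hX : MemLp X 2 μ) : gaussianSpace μ X ≃ₗᵢ[ℝ] CovSpace hX :=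
  (wienerIsometry hX).trans (covIsometry hX)

theorem gaussianIsometry_functional (hX : MemLp X 2 μ) (e' : DualBall E) :
    gaussianIsometry hX ⟨functional hX e', functional_mem hX e'⟩ = kernelFun hX e' :=
  (kernelFun_eq hX e').symm

theorem kernelFun_mem_closedKernelSpan (hX : MemLp X 2 μ) {𝓔 : Set (DualBall E)} {l : DualBall E}
    (hl : l ∈ 𝓔) : kernelFun hX l ∈ closedKernelSpan hX 𝓔 :=
  Submodule.le_topologicalClosure (Submodule.span ℝ (kernelFun hX '' 𝓔))
    (Submodule.subset_span (Set.mem_image_of_mem _ hl))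

/-- The closed span of the kernel functions `k_X(·, L'f')` contains the image of `G_{LX}`. -/
theorem gaussianIsometry_mem_closedKernelSpan (hX : MemLp X 2 μ) {L : E →L[ℝ] F}
    (hL : Y =ᵐ[μ] fun ω => L (X ω)) {g : gaussianSpace μ X}
    (hg : (g : Lp ℝ 2 μ) ∈ gaussianSpace μ Y) :
    gaussianIsometry hX g ∈ closedKernelSpan hX
      {l : DualBall E | ∃ f' : StrongDual ℝ F, (l : StrongDual ℝ E) = f' ∘L L} := by
  generalize h𝓔 : {l : DualBall E | ∃ f' : StrongDual ℝ F, (l : StrongDual ℝ E) = f' ∘L L} = 𝓔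
  have hC : IsClosed (closedKernelSpan hX 𝓔 : Set (CovSpace hX)) :=
    Submodule.isClosed_topologicalClosure _
  have hG : IsClosed (gaussianSpace μ X : Set (Lp ℝ 2 μ)) :=
    Submodule.isClosed_topologicalClosure _
  -- The density argument runs in `L²`, so the closed condition on the subtype `G_X` is pushed
  -- forward; its image stays closed since `G_X` is closed in `L²`.
  have hS := hG.isClosedEmbedding_subtypeVal.isClosedMap _
    (hC.preimage (gaussianIsometry hX).continuous)
  have hY (h : Lp ℝ 2 μ) (hh : h ∈ functionals μ Y) : ∃ k : gaussianSpace μ X,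
      gaussianIsometry hX k ∈ closedKernelSpan hX 𝓔 ∧ (k : Lp ℝ 2 μ) = h := by
    obtain ⟨r, l, hl, rfl⟩ := exists_eq_smul_functional hX hL hh
    refine ⟨r • ⟨functional hX l, functional_mem hX l⟩, ?_, rfl⟩
    rw [map_smul, gaussianIsometry_functional]
    exact Submodule.smul_mem _ _ (kernelFun_mem_closedKernelSpan hX (h𝓔 ▸ hl))
  obtain ⟨k, hk, hkg⟩ := gaussianSpace_induction hS hY hg
  rwa [← Subtype.val_injective hkg]

/-- The candidate lies in `H(𝓔)` by the previous lemma. The remainder need only be orthogonal to the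
generators `k_X(·, L'f')`, which are images of `f'(Y) ∈ G_Y`. -/
theorem starProjection_kernelFun (hX : MemLp X 2 μ) {L : E →L[ℝ] F}
    (hL : Y =ᵐ[μ] fun ω => L (X ω)) (hYX : gaussianSpace μ Y ≤ gaussianSpace μ X)
    (e' : DualBall E) :
    (closedKernelSpan hX
      {l : DualBall E | ∃ f' : StrongDual ℝ F, (l : StrongDual ℝ E) = f' ∘L L}).starProjection
        (kernelFun hX e') =
      gaussianIsometry hX ⟨(gaussianSpace μ Y).starProjection (functional hX e'),
        hYX (Submodule.starProjection_apply_mem _ _)⟩ := by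
  refine Submodule.eq_starProjection_of_mem_orthogonal
    (gaussianIsometry_mem_closedKernelSpan hX hL (Submodule.starProjection_apply_mem _ _)) ?_
  rw [closedKernelSpan, Submodule.orthogonal_closure, ← gaussianIsometry_functional, ← map_sub]
  refine (Submodule.mem_orthogonal' _ _).2 fun k hk => ?_
  induction hk using Submodule.span_induction with
  | zero => exact inner_zero_right _
  | add x y _ _ hx hy => rw [inner_add_right, hx, hy, add_zero]
  | smul c x _ hx => rw [inner_smul_right, hx, mul_zero]
  | mem k hk =>
    obtain ⟨l, ⟨f', hl⟩, rfl⟩ := hk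
    rw [← gaussianIsometry_functional, LinearIsometryEquiv.inner_map_map]
    have hlY : functional hX l ∈ gaussianSpace μ Y := by
      refine Submodule.le_topologicalClosure _ ⟨f', ?_⟩
      filter_upwards [coeFn_functional hX l, hL] with ω h1 h2
      rw [h1, h2, hl]
      rfl
    exact Submodule.starProjection_inner_eq_zero _ _ hlY

end Hilbert

/-! ### Measurability with respect to `σ(Y)` -/

section SigmaAlgebra

variable {Ω F : Type*} [NormedAddCommGroup F] [NormedSpace ℝ F] [MeasurableSpace F] [BorelSpace F]

/-- This inclusion lets independence from `Y` pass down to `sigmaAlg Y`. -/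
theorem sigmaAlg_le_comap (Y : Ω → F) : sigmaAlg Y ≤ MeasurableSpace.comap Y inferInstance := by
  refine iSup_le fun f' => ?_
  rw [← BorelSpace.measurable_eq (α := ℝ)]
  exact (f'.continuous.measurable.comp (comap_measurable Y)).comap_le

theorem sigmaAlg_le {mΩ : MeasurableSpace Ω} {Y : Ω → F} (hY : Measurable Y) : sigmaAlg Y ≤ mΩ :=
  (sigmaAlg_le_comap Y).trans hY.comap_le

theorem aestronglyMeasurable_of_mem_gaussianSpace {mΩ : MeasurableSpace Ω} {μ : Measure Ω}
    {Y : Ω → F} (hY : Measurable Y) {g : Lp ℝ 2 μ}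
    (hg : g ∈ gaussianSpace μ Y) : AEStronglyMeasurable[sigmaAlg Y] g μ := by
  refine gaussianSpace_induction (p := fun g => AEStronglyMeasurable[sigmaAlg Y] g μ)
    (isClosed_aestronglyMeasurable (sigmaAlg_le hY)) ?_ hg
  rintro g ⟨f', hf'⟩
  exact ⟨_, (measurable_apply_sigmaAlg Y f').stronglyMeasurable, hf'⟩

end SigmaAlgebra

/-! ### Continuity of means and characteristic functions on `L²` -/

section Lp

variable {Ω : Type*} {mΩ : MeasurableSpace Ω} {μ : Measure Ω} [IsProbabilityMeasure μ]

theorem integral_norm_le_norm_Lp_two (g : Lp ℝ 2 μ) : ∫ ω, ‖g ω‖ ∂μ ≤ ‖g‖ := by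
  rw [integral_norm_eq_lintegral_enorm (Lp.aestronglyMeasurable g), Lp.norm_def,
    ← eLpNorm_one_eq_lintegral_enorm]
  exact ENNReal.toReal_mono (Lp.eLpNorm_ne_top g)
    (eLpNorm_le_eLpNorm_of_exponent_le one_le_two (Lp.aestronglyMeasurable g))

theorem integrable_Lp_two (g : Lp ℝ 2 μ) : Integrable g μ :=
  (Lp.memLp g).integrable one_le_two

theorem norm_cexp_mul_I_sub_le (a b : ℝ) :
    ‖Complex.exp (a * Complex.I) - Complex.exp (b * Complex.I)‖ ≤ ‖a - b‖ := by
  have h : Complex.exp (a * Complex.I) - Complex.exp (b * Complex.I) =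
      Complex.exp (b * Complex.I) * (Complex.exp (Complex.I * (a - b : ℝ)) - 1) := by
    rw [mul_sub, ← Complex.exp_add, mul_one]
    congr 2
    push_cast
    ring
  rw [h, norm_mul, Complex.norm_exp_ofReal_mul_I, one_mul]
  exact Real.norm_exp_I_mul_ofReal_sub_one_le

theorem integrable_cexp_mul_I {f : Ω → ℝ} (hf : AEStronglyMeasurable f μ) :
    Integrable (fun ω => Complex.exp (f ω * Complex.I)) μ := by
  refine Integrable.of_bound (C := 1) ?_ (ae_of_all _ fun ω => ?_)
  · exact Continuous.comp_aestronglyMeasurable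
      (g := fun x : ℝ => Complex.exp (x * Complex.I)) (by fun_prop) hf
  · rw [Complex.norm_exp_ofReal_mul_I]

/-- The map is 1-Lipschitz: `t ↦ exp(it)` is, and the `L¹` norm is at most the `L²` norm on a
probability space. -/
theorem continuous_integral_cexp :
    Continuous fun g : Lp ℝ 2 μ => ∫ ω, Complex.exp (g ω * Complex.I) ∂μ := by
  refine (LipschitzWith.of_dist_le_mul (K := 1) fun g h => ?_).continuous
  rw [dist_eq_norm, dist_eq_norm, NNReal.coe_one, one_mul, ← integral_sub
    (integrable_cexp_mul_I (Lp.aestronglyMeasurable g))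
    (integrable_cexp_mul_I (Lp.aestronglyMeasurable h))]
  refine (norm_integral_le_integral_norm _).trans (le_trans ?_ (integral_norm_le_norm_Lp_two _))
  refine integral_mono_ae ?_ (integrable_Lp_two (g - h)).norm ?_
  · exact ((integrable_cexp_mul_I (Lp.aestronglyMeasurable g)).sub
      (integrable_cexp_mul_I (Lp.aestronglyMeasurable h))).norm
  · filter_upwards [Lp.coeFn_sub g h] with ω hω
    rw [hω]
    exact norm_cexp_mul_I_sub_le _ _

theorem continuous_integral_Lp_two : Continuous fun g : Lp ℝ 2 μ => ∫ ω, g ω ∂μ := by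
  refine (LipschitzWith.of_dist_le_mul (K := 1) fun g h => ?_).continuous
  rw [dist_eq_norm, dist_eq_norm, NNReal.coe_one, one_mul,
    ← integral_sub (integrable_Lp_two g) (integrable_Lp_two h)]
  refine le_trans (le_of_eq ?_) ((norm_integral_le_integral_norm _).trans
    (integral_norm_le_norm_Lp_two (g - h)))
  exact congrArg _ (integral_congr_ae (Lp.coeFn_sub g h).symm)

theorem integral_eq_zero_of_mem_gaussianSpace {E : Type*} [NormedAddCommGroup E] [NormedSpace ℝ E]
    [CompleteSpace E] {X : Ω → E} (hX : Integrable X μ) (hX0 : ∫ ω, X ω ∂μ = 0)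
    {g : Lp ℝ 2 μ} (hg : g ∈ gaussianSpace μ X) : ∫ ω, g ω ∂μ = 0 := by
  refine gaussianSpace_induction (p := fun g => ∫ ω, g ω ∂μ = 0)
    (isClosed_eq continuous_integral_Lp_two continuous_const) ?_ hg
  rintro g ⟨e', he'⟩
  rw [integral_congr_ae he', ContinuousLinearMap.integral_comp_comm _ hX, hX0, map_zero]

end Lp

/-! ### Gaussian laws, independence and conditional expectation -/

section Gaussian

variable {Ω E F : Type*} {mΩ : MeasurableSpace Ω} {μ : Measure Ω} [IsProbabilityMeasure μ]
  [NormedAddCommGroup E] [NormedSpace ℝ E] [CompleteSpace E]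
  [SecondCountableTopology E] [MeasurableSpace E] [BorelSpace E]
  [NormedAddCommGroup F] [NormedSpace ℝ F] [MeasurableSpace F] [BorelSpace F]
  {X : Ω → E} {Y : Ω → F}

/-- The elements of the Gaussian Hilbert space have centred Gaussian characteristic functions. -/
theorem integral_cexp_of_mem_gaussianSpace (hX : HasGaussianLaw X μ) (hX0 : ∫ ω, X ω ∂μ = 0)
    {g : Lp ℝ 2 μ} (hg : g ∈ gaussianSpace μ X) :
    ∫ ω, Complex.exp (g ω * Complex.I) ∂μ = Complex.exp (-‖g‖ ^ 2 / 2) := by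
  refine gaussianSpace_induction
    (p := fun g => ∫ ω, Complex.exp (g ω * Complex.I) ∂μ = Complex.exp (-‖g‖ ^ 2 / 2))
    (isClosed_eq continuous_integral_cexp (by fun_prop)) ?_ hg
  rintro g ⟨e', he'⟩
  have h := hX.charFunDual_map_eq_fun e'
  have h0 : ∫ ω, e' (X ω) ∂μ = 0 := by
    rw [ContinuousLinearMap.integral_comp_comm _ hX.integrable, hX0, map_zero]
  rw [h0, charFunDual_apply, integral_map hX.aemeasurable (by fun_prop),
    variance_of_integral_eq_zero (X := fun ω => e' (X ω))
      (e'.continuous.measurable.comp_aemeasurable hX.aemeasurable) h0] at h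
  have h1 : ∫ ω, e' (X ω) ^ 2 ∂μ = ‖g‖ ^ 2 := by
    rw [norm_sq_Lp_two]
    refine integral_congr_ae ?_
    filter_upwards [he'] with ω hω
    rw [hω]
  rw [h1] at h
  have h2 : ∫ ω, Complex.exp (g ω * Complex.I) ∂μ = ∫ ω, Complex.exp (e' (X ω) * Complex.I) ∂μ := by
    refine integral_congr_ae ?_
    filter_upwards [he'] with ω hω
    rw [hω]
  rw [h2, h]
  congr 1
  push_cast
  ring

/-- Each `f'(Z)` inherits from `g` mean zero, variance `‖g‖²` and a Gaussian characteristic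
function, which is the criterion for a Gaussian law. -/
theorem hasGaussianLaw_of_apply_mem_gaussianSpace (hX : HasGaussianLaw X μ)
    (hX0 : ∫ ω, X ω ∂μ = 0) {Z : Ω → F} (hZ : AEMeasurable Z μ)
    (h : ∀ f' : StrongDual ℝ F, ∃ g ∈ gaussianSpace μ X, g =ᵐ[μ] fun ω => f' (Z ω)) :
    HasGaussianLaw Z μ := by
  refine (hasGaussianLaw_iff_charFunDual_map_eq hZ).2 fun f' => ?_
  obtain ⟨g, hg, hgZ⟩ := h f'
  have h0 : ∫ ω, (f' ∘ Z) ω ∂μ = 0 := by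
    rw [← integral_eq_zero_of_mem_gaussianSpace hX.integrable hX0 hg]
    exact integral_congr_ae hgZ.symm
  have h1 : ∫ ω, (f' ∘ Z) ω ^ 2 ∂μ = ‖g‖ ^ 2 := by
    rw [norm_sq_Lp_two]
    refine integral_congr_ae ?_
    filter_upwards [hgZ] with ω hω
    rw [hω, Function.comp_apply]
  rw [h0, variance_of_integral_eq_zero (f'.continuous.measurable.comp_aemeasurable hZ) h0, h1,
    charFunDual_apply, integral_map hZ (by fun_prop)]
  have h2 := integral_cexp_of_mem_gaussianSpace hX hX0 hg
  have h3 : ∫ ω, Complex.exp (f' (Z ω) * Complex.I) ∂μ = ∫ ω, Complex.exp (g ω * Complex.I) ∂μ := by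
    refine integral_congr_ae ?_
    filter_upwards [hgZ] with ω hω
    rw [hω]
  rw [h3, h2]
  congr 1
  push_cast
  ring

variable [CompleteSpace F] [SecondCountableTopology F]

/-- In a Gaussian Hilbert space, orthogonality implies independence. -/
theorem indepFun_of_orthogonal (hX : HasGaussianLaw X μ) (hX0 : ∫ ω, X ω ∂μ = 0)
    (hY : HasGaussianLaw Y μ) (hYX : gaussianSpace μ Y ≤ gaussianSpace μ X)
    {g : Lp ℝ 2 μ} (hg : g ∈ gaussianSpace μ X) (hgY : g ∈ (gaussianSpace μ Y)ᗮ) :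
    IndepFun g Y μ := by
  have hgm : AEMeasurable g μ := (Lp.aestronglyMeasurable g).aemeasurable
  rw [indepFun_iff_charFunDual_prod hgm hY.aemeasurable]
  intro L
  -- Here `L` is a functional on `ℝ × F`; `c` and `f'` are its two components, so that `L(g, Y)` is
  -- the element `c • g + f` of `G_X`.
  set c : ℝ := L (1, 0)
  set f' : StrongDual ℝ F := L.comp (.inr ℝ ℝ F)
  set f := functional hY.memLp_two f'
  have hf : f ∈ gaussianSpace μ Y := functional_mem _ _
  have hL (a : ℝ) (y : F) : L (a, y) = c * a + f' y := by
    have : (a, y) = a • ((1 : ℝ), (0 : F)) + (0, y) := by simp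
    rw [this, map_add, map_smul, smul_eq_mul, mul_comm]
    rfl
  have h1 : charFunDual (μ.map fun ω => (g ω, Y ω)) L =
      ∫ ω, Complex.exp ((c • g + f : Lp ℝ 2 μ) ω * Complex.I) ∂μ := by
    rw [charFunDual_apply, integral_map (hgm.prodMk hY.aemeasurable) (by fun_prop)]
    refine integral_congr_ae ?_
    filter_upwards [Lp.coeFn_add (c • g) f, Lp.coeFn_smul c g,
      coeFn_functional hY.memLp_two f'] with ω h1 h2 h3
    rw [h1, Pi.add_apply, h2, h3, hL, Pi.smul_apply, smul_eq_mul]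
  have h2 : charFunDual (μ.map g) (L.comp (.inl ℝ ℝ F)) =
      ∫ ω, Complex.exp ((c • g : Lp ℝ 2 μ) ω * Complex.I) ∂μ := by
    rw [charFunDual_apply, integral_map hgm (by fun_prop)]
    refine integral_congr_ae ?_
    filter_upwards [Lp.coeFn_smul c g] with ω h2
    rw [h2, Pi.smul_apply, smul_eq_mul, ContinuousLinearMap.comp_apply,
      ContinuousLinearMap.inl_apply, hL, map_zero, add_zero]
  have h3 : charFunDual (μ.map Y) f' = ∫ ω, Complex.exp (f ω * Complex.I) ∂μ := by
    rw [charFunDual_apply, integral_map hY.aemeasurable (by fun_prop)]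
    refine integral_congr_ae ?_
    filter_upwards [coeFn_functional hY.memLp_two f'] with ω h3
    rw [h3]
  have hcg := Submodule.smul_mem _ c hg
  have horth : ⟪c • g, f⟫ = 0 := by
    rw [inner_smul_left, (Submodule.mem_orthogonal' _ _).1 hgY f hf, mul_zero]
  rw [h1, h2, h3, integral_cexp_of_mem_gaussianSpace hX hX0 (Submodule.add_mem _ hcg (hYX hf)),
    integral_cexp_of_mem_gaussianSpace hX hX0 hcg,
    integral_cexp_of_mem_gaussianSpace hX hX0 (hYX hf), ← Complex.exp_add]
  -- Pythagoras splits the Gaussian exponent, which factors the characteristic function.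
  have h4 := norm_add_sq_eq_norm_sq_add_norm_sq_real horth
  have h5 : ‖c • g + f‖ ^ 2 = ‖c • g‖ ^ 2 + ‖f‖ ^ 2 := by rw [pow_two, h4, pow_two, pow_two]
  congr 1
  rw [← Complex.ofReal_pow, h5]
  push_cast
  ring

/-- On the Gaussian Hilbert space of `X`, conditioning on `Y` is the orthogonal projection onto the
Gaussian Hilbert space of `Y`. -/
theorem condExp_eq_starProjection (hX : HasGaussianLaw X μ) (hX0 : ∫ ω, X ω ∂μ = 0)
    (hYm : Measurable Y) (hY : HasGaussianLaw Y μ)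
    (hYX : gaussianSpace μ Y ≤ gaussianSpace μ X) {g : Lp ℝ 2 μ} (hg : g ∈ gaussianSpace μ X) :
    μ[g | sigmaAlg Y] =ᵐ[μ] (gaussianSpace μ Y).starProjection g := by
  set p := (gaussianSpace μ Y).starProjection g
  have hp : p ∈ gaussianSpace μ Y := Submodule.starProjection_apply_mem _ g
  have hq : g - p ∈ gaussianSpace μ X := Submodule.sub_mem _ hg (hYX hp)
  have hind : IndepFun (g - p : Lp ℝ 2 μ) Y μ := indepFun_of_orthogonal hX hX0 hY hYX hq
    (Submodule.sub_starProjection_mem_orthogonal g)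
  have hm := sigmaAlg_le hYm
  have h1 : μ[(g - p : Lp ℝ 2 μ) | sigmaAlg Y] =ᵐ[μ] fun _ => 0 := by
    have h := condExp_indep_eq (f := (g - p : Lp ℝ 2 μ))
      (Lp.stronglyMeasurable (g - p)).measurable.comap_le hm
      (comap_measurable _).stronglyMeasurable
      (indep_of_indep_of_le_right hind (sigmaAlg_le_comap Y))
    rwa [integral_eq_zero_of_mem_gaussianSpace hX.integrable hX0 hq] at h
  have h2 : μ[p | sigmaAlg Y] =ᵐ[μ] p := condExp_of_aestronglyMeasurable' hm
    (aestronglyMeasurable_of_mem_gaussianSpace hYm hp) (integrable_Lp_two p)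
  have h3 : (g : Ω → ℝ) =ᵐ[μ] (g - p : Lp ℝ 2 μ) + p := by
    filter_upwards [Lp.coeFn_sub g p] with ω h
    rw [Pi.add_apply, h, Pi.sub_apply, sub_add_cancel]
  filter_upwards [condExp_congr_ae (m := sigmaAlg Y) h3, h1, h2,
    condExp_add (integrable_Lp_two (g - p)) (integrable_Lp_two p) (sigmaAlg Y)] with ω a b c d
  rw [a, d, Pi.add_apply, b, c, zero_add]

/-- Bounded functionals commute with conditional expectation, which reduces the vector-valued case
to the scalar one. -/
theorem apply_condExp_eq_starProjection (hX : HasGaussianLaw X μ) (hX0 : ∫ ω, X ω ∂μ = 0)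
    (hYm : Measurable Y) (hY : HasGaussianLaw Y μ)
    (hYX : gaussianSpace μ Y ≤ gaussianSpace μ X)
    {Z : Ω → E} (hZ : Z =ᵐ[μ] μ[X | sigmaAlg Y]) (e' : StrongDual ℝ E) :
    (gaussianSpace μ Y).starProjection (functional hX.memLp_two e') =ᵐ[μ] fun ω => e' (Z ω) := by
  filter_upwards [e'.comp_condExp_comm (m := sigmaAlg Y) hX.integrable, hZ,
    condExp_eq_starProjection hX hX0 hYm hY hYX (functional_mem hX.memLp_two e'),
    condExp_congr_ae (m := sigmaAlg Y) (coeFn_functional hX.memLp_two e')] with ω h1 h2 h3 h4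
  rw [← h3, h4, h2]
  exact h1.symm

end Gaussian

end GaussianConditioning

theorem mainTheorem7
    {Ω E F : Type*} {mΩ : MeasurableSpace Ω} (μ : Measure Ω) [IsProbabilityMeasure μ]
    [NormedAddCommGroup E] [NormedSpace ℝ E] [CompleteSpace E]
    [SecondCountableTopology E] [MeasurableSpace E] [BorelSpace E]
    [NormedAddCommGroup F] [NormedSpace ℝ F] [CompleteSpace F]
    [SecondCountableTopology F] [MeasurableSpace F] [BorelSpace F]
    (X : Ω → E) (Y : Ω → F) (hXm : Measurable X) (hYm : Measurable Y)
    (hXY : HasGaussianLaw (fun ω => (X ω, Y ω)) μ)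
    (hX0 : ∫ ω, X ω ∂μ = 0) (hY0 : ∫ ω, Y ω ∂μ = 0)
    (L : E →L[ℝ] F) (hL : Y =ᵐ[μ] fun ω => L (X ω))
    (Z : Ω → E) (hZ : Z =ᵐ[μ] μ[X | GaussianConditioning.sigmaAlg Y]) :
    ∃ hZG : HasGaussianLaw Z μ,
      ∫ ω, Z ω ∂μ = 0 ∧
      GaussianConditioning.gaussianSpace μ Z = GaussianConditioning.gaussianSpace μ Y ∧
      GaussianConditioning.gaussianSpace μ Y ≤ GaussianConditioning.gaussianSpace μ X ∧
      ∀ e₁ e' : GaussianConditioning.DualBall E,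
        RKHS.kernel (GaussianConditioning.CovSpace hZG.memLp_two) e₁ e' 1 =
          GaussianConditioning.covKernel μ Z e₁ e' ∧
        GaussianConditioning.covKernel μ Z e₁ e' =
          (GaussianConditioning.closedKernelSpan hXY.fst.memLp_two
            {l : GaussianConditioning.DualBall E |
              ∃ f' : StrongDual ℝ F, (l : StrongDual ℝ E) = f' ∘L L}).starProjection
            (GaussianConditioning.kernelFun hXY.fst.memLp_two e') e₁ := by
  have hX := hXY.fst
  have hY := hXY.snd
  have hYX : GaussianConditioning.gaussianSpace μ Y ≤ GaussianConditioning.gaussianSpace μ X :=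
    Submodule.topologicalClosure_mono (GaussianConditioning.functionals_le_of_ae_eq_comp hL)
  have hm := GaussianConditioning.sigmaAlg_le hYm
  have hP := GaussianConditioning.apply_condExp_eq_starProjection hX hX0 hYm hY hYX hZ
  have hZG : HasGaussianLaw Z μ :=
    GaussianConditioning.hasGaussianLaw_of_apply_mem_gaussianSpace hX hX0
      (((stronglyMeasurable_condExp.mono hm).aestronglyMeasurable.congr hZ.symm).aemeasurable)
      fun e' => ⟨_, hYX (Submodule.starProjection_apply_mem _ _), hP e'⟩
  have hfun (e' : StrongDual ℝ E) : GaussianConditioning.functional hZG.memLp_two e' =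
      (GaussianConditioning.gaussianSpace μ Y).starProjection
        (GaussianConditioning.functional hX.memLp_two e') :=
    Lp.ext ((GaussianConditioning.coeFn_functional _ _).trans (hP e').symm)
  refine ⟨hZG, ?_, le_antisymm ?_ ?_, hYX, fun e₁ e' =>
    ⟨GaussianConditioning.rkhs_kernel_covSpace _ _ _, ?_⟩⟩
  · rw [integral_congr_ae hZ, integral_condExp hm, hX0]
  · refine Submodule.topologicalClosure_minimal _ ?_ (Submodule.isClosed_topologicalClosure _)
    rintro g ⟨e', he'⟩
    rw [Lp.ext (he'.trans (hP e').symm)]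
    exact Submodule.starProjection_apply_mem _ _
  · refine Submodule.topologicalClosure_mono ?_
    rintro g ⟨f', hf'⟩
    refine ⟨f' ∘L L, ?_⟩
    have hg : GaussianConditioning.functional hX.memLp_two (f' ∘L L) = g := by
      refine Lp.ext ?_
      filter_upwards [GaussianConditioning.coeFn_functional hX.memLp_two (f' ∘L L), hf', hL]
        with ω h1 h2 h3
      rw [h1, h2, h3]
      rfl
    -- The projection fixes `g = f'(Y)`, so this identity exhibits `g` as the functional `f' ∘L L`
    -- of `Z`.
    have h := hP (f' ∘L L)
    have hgY : g ∈ GaussianConditioning.gaussianSpace μ Y :=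
      Submodule.le_topologicalClosure _ ⟨f', hf'⟩
    rwa [hg, Submodule.starProjection_eq_self_iff.2 hgY] at h
  · rw [GaussianConditioning.starProjection_kernelFun _ hL hYX,
      GaussianConditioning.covSpace_apply, GaussianConditioning.covSpace_val_apply,
      GaussianConditioning.covKernel_eq_inner hZG.memLp_two, hfun, hfun]
    -- Pulled back to `G_X`, the claim follows from the projection being self-adjoint and
    -- idempotent.
    refine Eq.trans ?_ (LinearIsometryEquiv.inner_map_map
      (GaussianConditioning.gaussianIsometry hX.memLp_two) _ _).symm
    rw [Submodule.inner_starProjection_left_eq_right, Submodule.starProjection_eq_self_iff.2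
      (Submodule.starProjection_apply_mem _ _)]
    rfl
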